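/- Let $d\ge 0$ be an integer and let $\lambda$ be a L\'evy measure on $\mathbb{R}^d$, i.e. a Borel measure with $\lambda(\{0\})=0$ and $\int(\|u\|^2\wedge 1)\,\lambda(du)<\infty$. Let $X$ be an infinitely divisible random vector in $\mathbb{R}^d$ with L\'evy measure $\lambda$, no Gaussian component and mean zero, i.e. $\mathbb{E}\,e^{i\langle t,X\rangle}=e^{-\Lambda_X(t)}$ for all $t\in\mathbb{R}^d$, where $$\Lambda_X(t)=\int\bigl(1+i\langle t,u\rangle-e^{i\langle t,u\rangle}\bigr)\,\lambda(du)$$ and the integral converges absolutely for every $t$. For each integer $n\ge 1$ let $U_n$ be a random vector with characteristic exponent $\Lambda_X/n$, i.e. $\mathbb{E}\,e^{i\langle t,U_n\rangle}=e^{-\Lambda_X(t)/n}$ for all $t$. Let $f:\mathbb{R}^d\to\mathbb{R}$ be continuous with $|f(x)|\le g(\|x\|)$ for all $x$, where $\|\cdot\|$ is the Euclidean norm and $g:[0,\infty)\to\mathbb{R}$ is continuous and nondecreasing with $g(t)=o(t^2)$ as $t\to 0+$. Suppose $\mathbb{E}\|X\|^2<\infty$ and that at least one of the following holds: 1. $\mathbb{E}\,g(c\|X'\|)<\infty$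 for some $c>1$, where $X'=X_1-X_2$ with $X_1,X_2$ independent copies of $X$; 2. $\mathbb{E}\,g(2c\|X\|)<\infty$ for some $c>1$; 3. $X$ is symmetric (i.e. $X$ and $-X$ have the same law) and $\mathbb{E}\,g(\|X\|)<\infty$. Then $f\in L^1(\lambda)$, $\mathbb{E}|f(U_n)|<\infty$ for every $n\ge 1$, and $$n\,\mathbb{E}f(U_n)\to\int f\,d\lambda\qquad\text{as } n\to\infty.$$ -/

import Mathlib

open MeasureTheory ProbabilityTheory Filter Topology Asymptotics

noncomputable section

/-- A Lévy measure on `ℝ^d`: no mass at the origin and `∫ min(‖u‖², 1) ν(du) < ∞`. -/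
structure IsLevyMeasure {d : ℕ} (ν : Measure (EuclideanSpace ℝ (Fin d))) : Prop where
  zero_mass : ν {0} = 0
  lintegral_lt_top : ∫⁻ u, ENNReal.ofReal (min (‖u‖ ^ 2) 1) ∂ν < ⊤

/-- The fully compensated Lévy–Khintchine integrand `1 + i⟨t,u⟩ - e^{i⟨t,u⟩}`. -/
def levyIntegrand {d : ℕ} (t u : EuclideanSpace ℝ (Fin d)) : ℂ :=
  1 + Complex.I * (inner ℝ t u : ℝ) - Complex.exp (Complex.I * (inner ℝ t u : ℝ))

/-- The characteristic exponent `Λ(t) = ∫ (1 + i⟨t,u⟩ - e^{i⟨t,u⟩}) ν(du)`. -/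
def levyExponent {d : ℕ} (ν : Measure (EuclideanSpace ℝ (Fin d)))
    (t : EuclideanSpace ℝ (Fin d)) : ℂ :=
  ∫ u, levyIntegrand t u ∂ν

/-- `μ` is the infinitely divisible law with Lévy measure `ν`, no Gaussian part and mean zero:
`ν` is a Lévy measure, the integral defining the exponent `Λ` converges absolutely for every `t`,
and the characteristic function of `μ` is `e^{-Λ}`. -/
structure IsCenteredPureJumpLaw {d : ℕ} (μ ν : Measure (EuclideanSpace ℝ (Fin d))) : Prop where
  isLevyMeasure : IsLevyMeasure ν
  integrable : ∀ t, Integrable (levyIntegrand t) ν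
  charFun_eq : ∀ t, charFun μ t = Complex.exp (-levyExponent ν t)

end

/-! Write σ for the law of X and μ_n for the law of U_n, so that σ is the n-fold convolution power
of μ_n. The proof combines convergence of n μ_n to ν on bounded sets with a bound on the tails of n
μ_n that is uniform in n.

Bounded sets: n(e^{-Λ/n} - 1) → -Λ pointwise. Second differences in t turn this into convergence of
the characteristic functions of the finite measures w · n μ_n to that of w · ν, where w(u) = ∑ᵢ (1 -
cos(h uᵢ)) behaves like ‖u‖² at 0; Lévy's convergence theorem gives weak convergence
(`tendsto_integral_mul_cosWeight`). After a radial cutoff f is o(‖u‖²) = o(w), so f / w is an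
admissible test function (`integrable_and_tendsto_integral_of_isLittleO`).

Tails: if X is symmetric, so is U_n, and Lévy's inequality gives n P(‖U_n‖ > t) ≤ 4 P(‖X‖ > t) for
large t (`natCast_mul_measure_lt_norm_le`). In general, tightness of the U_n allows symmetrization,
with bound 8 P(c‖X'‖ > t) (`exists_tail_bound_symmetrization`). The layer-cake formula turns tails
into moments of g, so the part of n E g(‖U_n‖) beyond radius R is small uniformly in n.
`levy_limit_of_tail_bound` joins the two halves; the moment condition on 2cX reduces to the one on
cX' because ‖X'‖ ≤ 2 max(‖X₁‖, ‖X₂‖). -/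

/-! ### Lévy's inequality, convolution roots and symmetrization. -/

section SymmetricSums

variable {E : Type*} [NormedAddCommGroup E] [InnerProductSpace ℝ E] [FiniteDimensional ℝ E]
  [MeasurableSpace E] [BorelSpace E]

/-- **Lévy's inequality** for the largest summand: for i.i.d. symmetric vectors, the probability
that some summand exceeds `t` in norm is at most twice the probability that the sum does. -/
theorem pi_exists_lt_norm_le_two_mul {n : ℕ} (μ : Measure E) [IsProbabilityMeasure μ]
    (hμ : μ.map Neg.neg = μ) (t : ℝ) :
    Measure.pi (fun _ : Fin n => μ) {x | ∃ i, t < ‖x i‖} ≤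
      2 * Measure.pi (fun _ : Fin n => μ) {x | t < ‖∑ i, x i‖} := by
  set m := Measure.pi (fun _ : Fin n => μ) with hm
  set B : Set (Fin n → E) := {x | t < ‖∑ i, x i‖} with hB
  -- `A j`: the first summand exceeding t is the j-th. `φ j` flips the sign of all the others; it
  -- preserves both the product law and `A j`.
  let A : Fin n → Set (Fin n → E) := fun j => {x | t < ‖x j‖ ∧ ∀ i < j, ‖x i‖ ≤ t}
  let φ : Fin n → (Fin n → E) → (Fin n → E) := fun j x i => if i = j then x i else -x i
  have hBm : MeasurableSet B := by
    refine measurableSet_lt measurable_const ?_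
    fun_prop
  have hAm (j) : MeasurableSet (A j) := by
    refine (measurableSet_lt measurable_const (measurable_pi_apply j).norm).inter ?_
    change MeasurableSet {x : Fin n → E | ∀ i < j, ‖x i‖ ≤ t}
    simp only [Set.ofPred_forall]
    exact MeasurableSet.iInter fun i => MeasurableSet.iInter fun _ =>
      measurableSet_le (measurable_pi_apply i).norm measurable_const
  have hφ (j) : MeasurePreserving (φ j) m m := by
    refine measurePreserving_pi (fun _ => μ) (fun _ => μ)
      (f := fun i x => if i = j then x else -x) fun i => ?_
    by_cases h : i = j
    · simpa [h] using! MeasurePreserving.id μ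
    · simpa [h] using (⟨measurable_neg, hμ⟩ : MeasurePreserving Neg.neg μ μ)
  have hsub (j) : A j ⊆ (A j ∩ B) ∪ φ j ⁻¹' (A j ∩ B) := by
    intro x hx
    have hφx : φ j x ∈ A j := by
      refine ⟨by simpa [φ] using hx.1, fun i hi => ?_⟩
      simpa [φ, hi.ne] using hx.2 i hi
    by_contra hcon
    have h1 : ‖∑ i, x i‖ ≤ t := by
      by_contra h
      exact hcon (Or.inl ⟨hx, not_le.1 h⟩)
    have h2 : ‖∑ i, φ j x i‖ ≤ t := by
      by_contra h
      exact hcon (Or.inr ⟨hφx, not_le.1 h⟩)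
    -- The sum and its reflection add up to 2 x_j, so they cannot both have norm at most t on `A j`.
    have h3 : (∑ i, x i) + ∑ i, φ j x i = (2 : ℝ) • x j := by
      rw [← Finset.sum_add_distrib, Finset.sum_eq_single j]
      · simp [φ, two_smul]
      · intro i _ hi
        simp [φ, hi]
      · simp
    have h4 : 2 * ‖x j‖ ≤ t + t := by
      calc 2 * ‖x j‖ = ‖(2 : ℝ) • x j‖ := by rw [norm_smul]; simp
        _ ≤ _ := by rw [← h3]; exact (norm_add_le _ _).trans (add_le_add h1 h2)
    linarith [hx.1]
  have hA2 (j) : m (A j) ≤ 2 * m (A j ∩ B) := by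
    calc m (A j) ≤ m (A j ∩ B) + m (φ j ⁻¹' (A j ∩ B)) :=
          (measure_mono (hsub j)).trans (measure_union_le _ _)
      _ = 2 * m (A j ∩ B) := by
          rw [(hφ j).measure_preimage ((hAm j).inter hBm).nullMeasurableSet, two_mul]
  have hcover : {x : Fin n → E | ∃ i, t < ‖x i‖} ⊆ ⋃ j, A j := by
    rintro x ⟨i, hi⟩
    obtain ⟨j, hj, hmin⟩ := WellFounded.has_min (wellFounded_lt (α := Fin n))
      {i | t < ‖x i‖} ⟨i, hi⟩
    exact Set.mem_iUnion.2 ⟨j, hj, fun k hk => not_lt.1 fun h => hmin k h hk⟩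
  have hdisj : Pairwise (Function.onFun Disjoint fun j => A j ∩ B) := by
    intro i j hij
    refine Set.disjoint_left.2 fun x hi hj => ?_
    rcases lt_or_gt_of_ne hij with h | h
    · exact absurd hi.1.1 (not_lt.2 (hj.1.2 i h))
    · exact absurd hj.1.1 (not_lt.2 (hi.1.2 j h))
  calc m {x | ∃ i, t < ‖x i‖} ≤ ∑ j, m (A j) :=
        (measure_mono hcover).trans (measure_iUnion_fintype_le _ _)
    _ ≤ ∑ j, 2 * m (A j ∩ B) := Finset.sum_le_sum fun j _ => hA2 j
    _ = 2 * m (⋃ j, A j ∩ B) := by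
        rw [← Finset.mul_sum, measure_iUnion hdisj fun j => (hAm j).inter hBm, tsum_fintype]
    _ ≤ 2 * m B := by
        gcongr
        exact Set.iUnion_subset fun j => Set.inter_subset_right

/-- If `σ` is the law of the sum of `n` i.i.d. symmetric vectors of law `μ`, then `n μ(‖x‖ > t)` is
controlled by `σ(‖x‖ > t)` as soon as the latter is at most `1/4`. -/
theorem natCast_mul_measure_lt_norm_le {n : ℕ} (μ σ : Measure E) [IsProbabilityMeasure μ]
    [IsProbabilityMeasure σ] (hμ : μ.map Neg.neg = μ)
    (h : ∀ t, charFun σ t = charFun μ t ^ n) {t : ℝ} (ht : σ.real {x | t < ‖x‖} ≤ 1 / 4) :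
    (n : ENNReal) * μ {x | t < ‖x‖} ≤ 4 * σ {x | t < ‖x‖} := by
  have hsum : (Measure.pi (fun _ : Fin n => μ)).map (fun p => ∑ i, p i) = σ := by
    have : IsProbabilityMeasure ((Measure.pi (fun _ : Fin n => μ)).map (fun p => ∑ i, p i)) :=
      Measure.isProbabilityMeasure_map (by fun_prop)
    refine Measure.ext_of_charFun ?_
    ext t
    rw [charFun_map_sum_pi_eq_prod, h]
    simp
  have hms : MeasurableSet {x : E | t < ‖x‖} := measurableSet_lt measurable_const measurable_norm
  have h1 := pi_exists_lt_norm_le_two_mul (n := n) μ hμ t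
  have h2 : Measure.pi (fun _ : Fin n => μ) {x | t < ‖∑ i, x i‖} = σ {x | t < ‖x‖} := by
    rw [← hsum, Measure.map_apply (by fun_prop) hms]
    rfl
  have hcompl : {x : Fin n → E | ∃ i, t < ‖x i‖} = (Set.univ.pi fun _ => {x : E | t < ‖x‖}ᶜ)ᶜ := by
    ext x
    simp
  have h3 : (Measure.pi (fun _ : Fin n => μ)).real {x | ∃ i, t < ‖x i‖} =
      1 - (1 - μ.real {x | t < ‖x‖}) ^ n := by
    rw [hcompl, probReal_compl_eq_one_sub (MeasurableSet.univ_pi fun _ => hms.compl),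
      measureReal_def, Measure.pi_pi, Finset.prod_const, ENNReal.toReal_pow, ← measureReal_def,
      probReal_compl_eq_one_sub hms]
    simp
  set p := μ.real {x | t < ‖x‖} with hp
  set q := σ.real {x | t < ‖x‖} with hq
  have h4 : 1 - (1 - p) ^ n ≤ 2 * q := by
    rw [← h3, hq, measureReal_def, measureReal_def, ← h2]
    have := ENNReal.toReal_mono (by finiteness) h1
    simpa using this
  have hp0 : 0 ≤ p := measureReal_nonneg
  have hp1 : p ≤ 1 := measureReal_le_one
  have hq0 : 0 ≤ q := measureReal_nonneg
  -- Bernoulli for (1 + p)^n yields 1 - (1 - p)^n ≥ np / (1 + np). With 2q ≤ 1/2 this inverts to np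
  -- ≤ 2q / (1 - 2q) ≤ 4q.
  have h5 : (1 - p) ^ n * (1 + n * p) ≤ 1 := by
    calc (1 - p) ^ n * (1 + n * p) ≤ (1 - p) ^ n * (1 + p) ^ n := by
          exact mul_le_mul_of_nonneg_left (one_add_mul_le_pow (by linarith) n)
            (pow_nonneg (by linarith) n)
      _ = (1 - p ^ 2) ^ n := by rw [← mul_pow]; ring
      _ ≤ 1 := by
          have : p ^ 2 ≤ 1 := pow_le_one₀ hp0 hp1
          exact pow_le_one₀ (by linarith) (by linarith [sq_nonneg p])
  have hnp : 0 ≤ n * p := by positivity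
  have h6 : n * p ≤ 4 * q := by nlinarith
  have h7 := ENNReal.ofReal_le_ofReal h6
  rwa [ENNReal.ofReal_mul (by positivity), ENNReal.ofReal_mul (by positivity), hp, hq,
    ofReal_measureReal, ofReal_measureReal, ENNReal.ofReal_natCast, ENNReal.ofReal_ofNat] at h7

/-- An `n`-th convolution root, with nonvanishing characteristic function, of a symmetric law
is symmetric. -/
theorem map_neg_eq_self_of_charFun_pow {n : ℕ} (hn : n ≠ 0) (μ σ : Measure E)
    [IsProbabilityMeasure μ] [IsProbabilityMeasure σ] (hσ : σ.map Neg.neg = σ)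
    (h : ∀ t, charFun σ t = charFun μ t ^ n) (h0 : ∀ t, charFun μ t ≠ 0) :
    μ.map Neg.neg = μ := by
  have hneg (ρ : Measure E) (t : E) : charFun (ρ.map Neg.neg) t = charFun ρ (-t) := by
    have := charFun_map_smul (μ := ρ) (-1) t
    simpa [neg_one_smul] using! this
  have : IsProbabilityMeasure (μ.map Neg.neg) :=
    Measure.isProbabilityMeasure_map measurable_neg.aemeasurable
  have hroot (t : E) : charFun μ (-t) ^ n = charFun μ t ^ n := by
    rw [← h, ← h, ← hneg, hσ]
  -- This ratio is continuous on a connected space with values in the finite set of n-th roots of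
  -- unity, hence constant, and it is 1 at the origin.
  let z : E → ℂ := fun t => charFun μ (-t) / charFun μ t
  have hz : Continuous z :=
    (continuous_charFun.comp continuous_neg).div continuous_charFun h0
  have hfin : {w : ℂ | w ^ n = 1}.Finite := by
    refine ((Polynomial.nthRoots n (1 : ℂ)).toFinset.finite_toSet).subset fun w hw => ?_
    simpa [Polynomial.mem_nthRoots (Nat.pos_of_ne_zero hn)] using hw
  refine Measure.ext_of_charFun ?_
  ext t
  have hzt : z t = z 0 := isPreconnected_univ.constant_of_mapsTo hfin.isDiscrete hz.continuousOn
    (fun s _ => by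
      simp only [z, Set.mem_ofPred_eq, div_pow, hroot]
      exact div_self (pow_ne_zero n (h0 s))) (Set.mem_univ _) (Set.mem_univ _)
  have hz0 : z 0 = 1 := by simp [z]
  rw [hneg]
  exact (div_eq_one_iff_eq (h0 t)).1 (hzt.trans hz0)

/-- The law of `X - Y` for `X`, `Y` independent of law `μ`. -/
noncomputable def symmetrization (μ : Measure E) : Measure E :=
  (μ.prod μ).map fun p => p.1 - p.2

instance (μ : Measure E) [IsProbabilityMeasure μ] : IsProbabilityMeasure (symmetrization μ) :=
  Measure.isProbabilityMeasure_map (by fun_prop)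

theorem symmetrization_map_neg (μ : Measure E) [IsProbabilityMeasure μ] :
    (symmetrization μ).map Neg.neg = symmetrization μ := by
  rw [symmetrization, Measure.map_map measurable_neg (by fun_prop)]
  conv_rhs => rw [← Measure.prod_swap, Measure.map_map (by fun_prop) measurable_swap]
  congr 1
  ext p
  simp

theorem charFun_symmetrization (μ : Measure E) [IsProbabilityMeasure μ] (t : E) :
    charFun (symmetrization μ) t = charFun μ t * charFun μ (-t) := by
  have : symmetrization μ = (μ.prod (μ.map Neg.neg)).map fun p => p.1 + p.2 := by
    have h : μ.prod (μ.map Neg.neg) = (μ.prod μ).map (Prod.map id Neg.neg) := by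
      conv_lhs => rw [← Measure.map_id (μ := μ)]
      rw [Measure.map_map measurable_neg measurable_id]
      exact Measure.map_prod_map _ _ measurable_id measurable_neg
    rw [h, Measure.map_map (by fun_prop) (measurable_id.prodMap measurable_neg), symmetrization]
    congr 1
    ext p
    simp [sub_eq_add_neg]
  have hp : IsProbabilityMeasure (μ.map (Neg.neg : E → E)) :=
    Measure.isProbabilityMeasure_map measurable_neg.aemeasurable
  rw [this, charFun_map_add_prod_eq_mul, Pi.mul_apply]
  have := charFun_map_smul (μ := μ) (-1) t
  congr 1
  simpa [neg_one_smul] using! this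

/-- An independent copy has norm at most s with probability at least 1/2, and subtracting it costs
at most s ≤ (1 - 1/c) t in norm. The loss from t to t/c is why a constant c > 1 enters the moment
conditions. -/
theorem measure_lt_norm_le_two_mul_symmetrization (μ : Measure E) [IsProbabilityMeasure μ]
    {c t s : ℝ} (hc : 0 < c) (hs : s ≤ (1 - c⁻¹) * t) (h : 1 / 2 ≤ μ {x | ‖x‖ ≤ s}) :
    μ {x | t < ‖x‖} ≤ 2 * symmetrization μ {x | t < c * ‖x‖} := by
  have hms : MeasurableSet {x : E | t < c * ‖x‖} :=
    measurableSet_lt measurable_const (by fun_prop)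
  have h1 : {x : E | t < ‖x‖} ×ˢ {x : E | ‖x‖ ≤ s} ⊆
      (fun p : E × E => p.1 - p.2) ⁻¹' {x | t < c * ‖x‖} := by
    rintro ⟨x, y⟩ ⟨hx, hy⟩
    simp only [Set.mem_ofPred_eq, Set.mem_preimage] at hx hy ⊢
    have h2 := norm_sub_norm_le x y
    have h3 : c⁻¹ * t < ‖x - y‖ := by linarith
    calc t = c * (c⁻¹ * t) := by field_simp
      _ < _ := by gcongr
  have h2 := measure_mono (μ := μ.prod μ) h1
  rw [Measure.prod_prod] at h2
  rw [symmetrization, Measure.map_apply (by fun_prop) hms]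
  calc μ {x | t < ‖x‖} = 2 * (μ {x | t < ‖x‖} * (1 / 2)) := by
        rw [mul_comm, mul_assoc, one_div, ENNReal.inv_mul_cancel (by simp) (by simp), mul_one]
    _ ≤ 2 * (μ {x | t < ‖x‖} * μ {x | ‖x‖ ≤ s}) := by gcongr
    _ ≤ _ := by gcongr

end SymmetricSums

/-! ### From tails to moments. -/

/-- Comparison of tails yields comparison of truncated moments of a monotone function. -/
theorem setLIntegral_le_of_measure_lt_norm_le {E : Type*} [NormedAddCommGroup E]
    [MeasurableSpace E] [BorelSpace E] {μ σ : Measure E} [SFinite μ] [SFinite σ]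
    {a C : ENNReal} {c T R : ℝ}
    (hc : 0 ≤ c) (hR0 : 0 ≤ R) (hTR : T ≤ R)
    (h : ∀ t, T ≤ t → a * μ {x | t < ‖x‖} ≤ C * σ {x | t < c * ‖x‖})
    {g : ℝ → ℝ} (hg_cont : ContinuousOn g (Set.Ici 0)) (hg_mono : MonotoneOn g (Set.Ici 0))
    (hg0 : ∀ t, 0 ≤ t → 0 ≤ g t) :
    a * ∫⁻ x in {x | R < ‖x‖}, ENNReal.ofReal (g ‖x‖) ∂μ ≤
      C * ∫⁻ x in {x | R < c * ‖x‖}, ENNReal.ofReal (g (c * ‖x‖)) ∂σ := by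
  have hcont : Continuous fun x : E => g ‖x‖ :=
    hg_cont.comp_continuous continuous_norm fun x => norm_nonneg x
  have hcont' : Continuous fun x : E => g (c * ‖x‖) :=
    hg_cont.comp_continuous (by fun_prop) fun x => mul_nonneg hc (norm_nonneg x)
  have hm1 : MeasurableSet {x : E | R < ‖x‖} := measurableSet_lt measurable_const measurable_norm
  have hm2 : MeasurableSet {x : E | R < c * ‖x‖} :=
    measurableSet_lt measurable_const (by fun_prop)
  -- Layer cake on both sides reduces the claim to superlevel sets.
  rw [lintegral_eq_lintegral_meas_lt _ (ae_of_all _ fun x => hg0 _ (norm_nonneg x))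
      hcont.aemeasurable,
    lintegral_eq_lintegral_meas_lt _ (ae_of_all _ fun x => hg0 _ (mul_nonneg hc (norm_nonneg x)))
      hcont'.aemeasurable]
  have hanti1 : Antitone fun s => (μ.restrict {x : E | R < ‖x‖}) {x | s < g ‖x‖} :=
    fun s s' hs => measure_mono fun x (hx : s' < _) => hs.trans_lt hx
  have hanti2 : Antitone fun s => (σ.restrict {x : E | R < c * ‖x‖}) {x | s < g (c * ‖x‖)} :=
    fun s s' hs => measure_mono fun x (hx : s' < _) => hs.trans_lt hx
  rw [← lintegral_const_mul _ hanti1.measurable, ← lintegral_const_mul _ hanti2.measurable]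
  refine lintegral_mono fun s => ?_
  rw [Measure.restrict_apply (measurableSet_lt measurable_const hcont.measurable),
    Measure.restrict_apply (measurableSet_lt measurable_const hcont'.measurable)]
  -- the superlevel set of `g` beyond `R` is empty or an open half-line
  let S : Set ℝ := {r | R < r ∧ s < g r}
  have hS : S = ∅ ∨ ∃ b, R ≤ b ∧ S = Set.Ioi b := by
    rcases S.eq_empty_or_nonempty with h0 | hne
    · exact Or.inl h0
    have hbdd : BddBelow S := ⟨R, fun r hr => hr.1.le⟩
    -- Continuity of g makes the half-line open, which matches the strict inequality in the tail
    -- hypothesis.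
    have hopen : IsOpen S := by
      have := (hg_cont.mono (Set.Ioi_subset_Ici hR0)).isOpen_inter_preimage isOpen_Ioi
        (isOpen_Ioi (a := s))
      exact this
    refine Or.inr ⟨sInf S, le_csInf hne fun r hr => hr.1.le, ?_⟩
    ext r
    constructor
    · intro hr
      obtain ⟨ε, hε, hball⟩ := Metric.isOpen_iff.1 hopen r hr
      have : r - ε / 2 ∈ S := hball (by
        rw [Metric.mem_ball, Real.dist_eq]
        rw [show r - ε / 2 - r = -(ε / 2) by ring, abs_neg, abs_of_pos (by positivity)]
        linarith)
      exact (csInf_le hbdd this).trans_lt (by linarith)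
    · intro hr
      obtain ⟨r', hr', hlt⟩ := (csInf_lt_iff hbdd hne).1 hr
      have h0 : 0 ≤ r' := hR0.trans hr'.1.le
      exact ⟨hr'.1.trans hlt, hr'.2.trans_le (hg_mono h0 (h0.trans hlt.le) hlt.le)⟩
  have e1 : {x : E | s < g ‖x‖} ∩ {x | R < ‖x‖} = {x | ‖x‖ ∈ S} := by
    ext x; exact and_comm
  have e2 : {x : E | s < g (c * ‖x‖)} ∩ {x | R < c * ‖x‖} = {x | c * ‖x‖ ∈ S} := by
    ext x; exact and_comm
  rw [e1, e2]
  rcases hS with h0 | ⟨b, hb, hSb⟩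
  · simp [h0]
  · simpa [hSb] using h b (hTR.trans hb)

/-! ### Weak convergence of finite measures from characteristic functions. -/

section FiniteLevyContinuity

variable {E : Type*} [NormedAddCommGroup E] [InnerProductSpace ℝ E] [FiniteDimensional ℝ E]
  [MeasurableSpace E] [BorelSpace E]

/-- **Lévy's convergence theorem** for finite measures. -/
theorem finiteMeasure_tendsto_of_tendsto_charFun {ρ : ℕ → FiniteMeasure E} {ρ₀ : FiniteMeasure E}
    (h : ∀ t : E, Tendsto (fun n => charFun (ρ n : Measure E) t) atTop
      (𝓝 (charFun (ρ₀ : Measure E) t))) :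
    Tendsto ρ atTop (𝓝 ρ₀) := by
  have hmass : Tendsto (fun n => (ρ n).mass) atTop (𝓝 ρ₀.mass) := by
    have h0 := (Complex.continuous_re.tendsto _).comp (h 0)
    simp only [charFun_zero, Function.comp_def, Complex.ofReal_re] at h0
    exact NNReal.tendsto_coe.1 h0
  -- The proof normalizes to probability measures, which makes sense only for a nonzero limit; for a
  -- zero limit, vanishing mass is enough.
  by_cases h0 : ρ₀ = 0
  · subst h0
    exact FiniteMeasure.tendsto_zero_of_tendsto_zero_mass (by simpa using hmass)
  have hm0 : ρ₀.mass ≠ 0 := ρ₀.mass_nonzero_iff.2 h0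
  refine FiniteMeasure.tendsto_of_tendsto_normalize_testAgainstNN_of_tendsto_mass ?_ hmass
  refine ProbabilityMeasure.tendsto_of_tendsto_charFun fun t => ?_
  have hcf (κ : FiniteMeasure E) (hκ : κ ≠ 0) :
      charFun (κ.normalize : Measure E) t = ((κ.mass : ℝ) : ℂ)⁻¹ * charFun (κ : Measure E) t := by
    rw [κ.toMeasure_normalize_eq_of_nonzero hκ, charFun_apply, charFun_apply,
      integral_smul_nnreal_measure]
    simp [NNReal.smul_def]
  rw [hcf ρ₀ h0]
  have hlim : Tendsto (fun n => (((ρ n).mass : ℝ) : ℂ)⁻¹ * charFun (ρ n : Measure E) t) atTop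
      (𝓝 (((ρ₀.mass : ℝ) : ℂ)⁻¹ * charFun (ρ₀ : Measure E) t)) := by
    refine Tendsto.mul (Tendsto.inv₀ ?_ (by simpa using hm0)) (h t)
    exact (Complex.continuous_ofReal.tendsto _).comp (NNReal.tendsto_coe.2 hmass)
  refine hlim.congr' ?_
  filter_upwards [hmass.eventually_ne hm0] with n hn
  exact (hcf _ ((ρ n).mass_nonzero_iff.1 hn)).symm

end FiniteLevyContinuity

/-- `N (e^{-z/N} - 1) → -z`. -/
theorem tendsto_natCast_mul_exp_sub_one (z : ℂ) :
    Tendsto (fun n : ℕ => ((n : ℂ) + 1) * (Complex.exp (-(z / ((n : ℂ) + 1))) - 1)) atTop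
      (𝓝 (-z)) := by
  -- The expression is the difference quotient at 0 of w ↦ e^{-zw} with increment w = 1/(n + 1).
  have hd : HasDerivAt (fun w : ℂ => Complex.exp (w * -z)) (-z) 0 := by
    simpa using ((hasDerivAt_id (0 : ℂ)).mul_const (-z)).cexp
  have h1 := hd.tendsto_slope_zero
  have hne (n : ℕ) : (n : ℂ) + 1 ≠ 0 := by exact_mod_cast Nat.succ_ne_zero n
  have h2 : Tendsto (fun n : ℕ => ((n : ℂ) + 1)⁻¹) atTop (𝓝[≠] 0) := by
    refine tendsto_nhdsWithin_iff.2 ⟨?_, Eventually.of_forall fun n => inv_ne_zero (hne n)⟩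
    simpa using tendsto_one_div_add_atTop_nhds_zero_nat (𝕜 := ℂ)
  refine (h1.comp h2).congr fun n => ?_
  simp [div_eq_mul_inv, mul_comm]

/-! ### Convergence on bounded sets through the cosine weight. -/

section Weight

variable {d : ℕ}

local notation "𝔼" => EuclideanSpace ℝ (Fin d)

/-- The weight `∑ᵢ (1 - cos (h uᵢ))`, comparable to `‖u‖²` near the origin. -/
noncomputable def cosWeight (h : ℝ) (u : 𝔼) : ℝ := ∑ i, (1 - Real.cos (h * u i))

theorem continuous_cosWeight (h : ℝ) : Continuous (cosWeight h : 𝔼 → ℝ) := by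
  unfold cosWeight
  fun_prop

theorem cosWeight_nonneg (h : ℝ) (u : 𝔼) : 0 ≤ cosWeight h u :=
  Finset.sum_nonneg fun _ _ => sub_nonneg.2 (Real.cos_le_one _)

/-- Coordinatewise use of 1 - cos x ≥ (2/π²) x² for |x| ≤ π; the bound 2 ≤ π keeps every coordinate
in range. -/
theorem mul_norm_sq_le_cosWeight {h : ℝ} {u : 𝔼} (hu : |h| * ‖u‖ ≤ 2) :
    2 / Real.pi ^ 2 * h ^ 2 * ‖u‖ ^ 2 ≤ cosWeight h u := by
  rw [EuclideanSpace.norm_sq_eq, Finset.mul_sum]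
  refine Finset.sum_le_sum fun i _ => ?_
  have h1 : |h * u i| ≤ Real.pi := by
    rw [abs_mul]
    have : |u i| ≤ ‖u‖ := PiLp.norm_apply_le u i
    have := mul_le_mul_of_nonneg_left this (abs_nonneg h)
    linarith [Real.two_le_pi]
  have h2 := Real.cos_le_one_sub_mul_cos_sq h1
  rw [Real.norm_eq_abs, sq_abs]
  linarith [h2, mul_pow h (u i) 2]

theorem charFun_withDensity_cosWeight {ρ : Measure 𝔼} (h : ℝ)
    (hint : ∀ i, Integrable (fun u : 𝔼 => 1 - Real.cos (h * u i)) ρ) (t : 𝔼) :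
    charFun (ρ.withDensity fun u => ENNReal.ofReal (cosWeight h u)) t =
      ∑ i, ∫ u, Complex.exp ((inner ℝ u t : ℝ) * Complex.I) *
        ((1 - Real.cos (h * u i) : ℝ) : ℂ) ∂ρ := by
  rw [charFun_apply, integral_withDensity_eq_integral_toReal_smul
    (continuous_cosWeight h).measurable.ennreal_ofReal (by simp), ← integral_finsetSum]
  · refine integral_congr_ae (ae_of_all _ fun u => ?_)
    simp only [ENNReal.toReal_ofReal (cosWeight_nonneg h u)]
    rw [cosWeight, Complex.real_smul, Complex.ofReal_sum, Finset.sum_mul]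
    exact Finset.sum_congr rfl fun i _ => mul_comm _ _
  · intro i _
    refine (hint i).ofReal.bdd_mul (c := 1) (by fun_prop) (ae_of_all _ fun u => ?_)
    simp [Complex.norm_exp]

/-- Multiplying by 1 - cos amounts to a second difference in the frequency, so weighted
characteristic functions can be read off unweighted ones. -/
theorem exp_mul_one_sub_cos (a b : ℝ) :
    Complex.exp (a * Complex.I) * ((1 - Real.cos b : ℝ) : ℂ) =
      Complex.exp (a * Complex.I) - Complex.exp ((a + b : ℝ) * Complex.I) / 2
        - Complex.exp ((a - b : ℝ) * Complex.I) / 2 := by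
  push_cast
  rw [Complex.cos, add_mul, sub_mul, sub_eq_add_neg (_ * Complex.I), Complex.exp_add,
    Complex.exp_add, neg_mul]
  ring

theorem inner_add_single (u t : 𝔼) (h : ℝ) (i : Fin d) :
    inner ℝ u (t + EuclideanSpace.single i h) = inner ℝ u t + h * u i := by
  rw [inner_add_right, EuclideanSpace.inner_single_right]
  simp

theorem inner_sub_single (u t : 𝔼) (h : ℝ) (i : Fin d) :
    inner ℝ u (t - EuclideanSpace.single i h) = inner ℝ u t - h * u i := by
  rw [inner_sub_right, EuclideanSpace.inner_single_right]
  simp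

theorem integral_exp_mul_one_sub_cos (μ : Measure 𝔼) [IsProbabilityMeasure μ] (t : 𝔼) (h : ℝ)
    (i : Fin d) :
    ∫ u, Complex.exp ((inner ℝ u t : ℝ) * Complex.I) * ((1 - Real.cos (h * u i) : ℝ) : ℂ) ∂μ =
      charFun μ t - charFun μ (t + EuclideanSpace.single i h) / 2
        - charFun μ (t - EuclideanSpace.single i h) / 2 := by
  have hi (s : 𝔼) : Integrable (fun u => Complex.exp ((inner ℝ u s : ℝ) * Complex.I)) μ := by
    refine Integrable.of_bound (by fun_prop) 1 (ae_of_all _ fun u => ?_)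
    simp [Complex.norm_exp]
  have hi2 : Integrable (fun u => Complex.exp ((inner ℝ u t : ℝ) * Complex.I) -
      Complex.exp ((inner ℝ u (t + EuclideanSpace.single i h) : ℝ) * Complex.I) / 2) μ :=
    (hi _).sub ((hi _).div_const 2)
  simp only [charFun_apply]
  rw [← integral_div, ← integral_div, ← integral_sub (hi _) ((hi _).div_const 2),
    ← integral_sub hi2 ((hi _).div_const 2)]
  refine integral_congr_ae (ae_of_all _ fun u => ?_)
  simp only [inner_add_single, inner_sub_single]
  exact exp_mul_one_sub_cos _ _

/-- The second difference kills the affine part 1 + i⟨t,u⟩, so the compensator disappears and only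
exponentials remain. -/
theorem exp_mul_one_sub_cos_eq_levyIntegrand (t u : 𝔼) (h : ℝ) (i : Fin d) :
    Complex.exp ((inner ℝ u t : ℝ) * Complex.I) * ((1 - Real.cos (h * u i) : ℝ) : ℂ) =
      levyIntegrand (t + EuclideanSpace.single i h) u / 2
        + levyIntegrand (t - EuclideanSpace.single i h) u / 2 - levyIntegrand t u := by
  rw [exp_mul_one_sub_cos]
  simp only [levyIntegrand, real_inner_comm u, inner_add_single, inner_sub_single]
  simp only [mul_comm Complex.I]
  push_cast
  ring

theorem integral_exp_mul_one_sub_cos_eq_levyExponent {ν : Measure 𝔼}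
    (hν : ∀ t, Integrable (levyIntegrand t) ν) (t : 𝔼) (h : ℝ) (i : Fin d) :
    ∫ u, Complex.exp ((inner ℝ u t : ℝ) * Complex.I) * ((1 - Real.cos (h * u i) : ℝ) : ℂ) ∂ν =
      levyExponent ν (t + EuclideanSpace.single i h) / 2
        + levyExponent ν (t - EuclideanSpace.single i h) / 2 - levyExponent ν t := by
  have hi : Integrable (fun u => levyIntegrand (t + EuclideanSpace.single i h) u / 2
      + levyIntegrand (t - EuclideanSpace.single i h) u / 2) ν :=
    ((hν _).div_const 2).add ((hν _).div_const 2)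
  simp only [exp_mul_one_sub_cos_eq_levyIntegrand, levyExponent]
  rw [← integral_div, ← integral_div, ← integral_add ((hν _).div_const 2) ((hν _).div_const 2),
    ← integral_sub hi (hν _)]

/-- This is the real part of the Lévy integrand at t = h eᵢ. -/
theorem integrable_one_sub_cos_of_levyIntegrand {ν : Measure 𝔼}
    (hν : ∀ t, Integrable (levyIntegrand t) ν) (h : ℝ) (i : Fin d) :
    Integrable (fun u : 𝔼 => 1 - Real.cos (h * u i)) ν := by
  have h1 := (hν (EuclideanSpace.single i h)).re
  refine h1.congr (ae_of_all _ fun u => ?_)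
  have : inner ℝ (EuclideanSpace.single i h) u = h * u i := by
    rw [EuclideanSpace.inner_single_left]
    simp
  simp only [levyIntegrand, this, mul_comm Complex.I]
  simp only [map_sub, map_add, RCLike.re_to_complex, Complex.exp_ofReal_mul_I_re]
  simp

theorem integrable_cosWeight {ν : Measure 𝔼}
    (hν : ∀ t, Integrable (levyIntegrand t) ν) (h : ℝ) : Integrable (cosWeight h) ν :=
  integrable_finsetSum _ fun i _ => integrable_one_sub_cos_of_levyIntegrand hν h i

/-- Weighted by `cosWeight h`, the measures `N μ_N` converge weakly to the Lévy measure. -/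
theorem tendsto_integral_mul_cosWeight {ν : Measure 𝔼}
    (hν : ∀ t, Integrable (levyIntegrand t) ν) (μ : ℕ → Measure 𝔼)
    [∀ n, IsProbabilityMeasure (μ n)]
    (hμ : ∀ (n : ℕ) t, charFun (μ n) t = Complex.exp (-(levyExponent ν t / ((n : ℂ) + 1))))
    (h : ℝ) {F : 𝔼 → ℝ} (hF : Continuous F) (hFc : HasCompactSupport F) :
    Tendsto (fun n : ℕ => ((n : ℝ) + 1) * ∫ u, F u * cosWeight h u ∂(μ n)) atTop
      (𝓝 (∫ u, F u * cosWeight h u ∂ν)) := by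
  have hmeas : Measurable fun u : 𝔼 => ENNReal.ofReal (cosWeight h u) :=
    (continuous_cosWeight h).measurable.ennreal_ofReal
  have hi1 (n) (i : Fin d) : Integrable (fun u : 𝔼 => 1 - Real.cos (h * u i)) (μ n) := by
    refine Integrable.of_bound (by fun_prop) 2 (ae_of_all _ fun u => ?_)
    rw [Real.norm_eq_abs, abs_le]
    constructor <;> linarith [Real.neg_one_le_cos (h * u i), Real.cos_le_one (h * u i)]
  have hfin (ρ : Measure 𝔼) (hρ : Integrable (cosWeight h) ρ) :
      IsFiniteMeasure (ρ.withDensity fun u => ENNReal.ofReal (cosWeight h u)) :=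
    isFiniteMeasure_withDensity_ofReal hρ.2
  have hwn (n) : Integrable (cosWeight h) (μ n) := integrable_finsetSum _ fun i _ => hi1 n i
  have hfn (n : ℕ) := hfin (μ n) (hwn n)
  have hfν := hfin ν (integrable_cosWeight hν h)
  let κ : ℕ → FiniteMeasure 𝔼 := fun n =>
    ((n : NNReal) + 1) • ⟨(μ n).withDensity fun u => ENNReal.ofReal (cosWeight h u), hfn n⟩
  let κ₀ : FiniteMeasure 𝔼 := ⟨ν.withDensity fun u => ENNReal.ofReal (cosWeight h u), hfν⟩
  have hκ (n) : (κ n : Measure 𝔼) =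
    ((n : NNReal) + 1) • (μ n).withDensity fun u => ENNReal.ofReal (cosWeight h u) := rfl
  have hκ₀ : (κ₀ : Measure 𝔼) = ν.withDensity fun u => ENNReal.ofReal (cosWeight h u) := rfl
  have hlim : Tendsto κ atTop (𝓝 κ₀) := by
    refine finiteMeasure_tendsto_of_tendsto_charFun fun t => ?_
    have e1 (n) : charFun (κ n : Measure 𝔼) t = ((n : ℂ) + 1) *
        ∑ i, (charFun (μ n) t - charFun (μ n) (t + EuclideanSpace.single i h) / 2
        - charFun (μ n) (t - EuclideanSpace.single i h) / 2) := by
      simp only [← integral_exp_mul_one_sub_cos]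
      rw [← charFun_withDensity_cosWeight h (hi1 n), hκ, charFun_apply,
        integral_smul_nnreal_measure, ← charFun_apply, NNReal.smul_def, Complex.real_smul]
      simp
    have e2 : charFun (κ₀ : Measure 𝔼) t =
        ∑ i, (-levyExponent ν t - -levyExponent ν (t + EuclideanSpace.single i h) / 2
          - -levyExponent ν (t - EuclideanSpace.single i h) / 2) := by
      rw [hκ₀, charFun_withDensity_cosWeight h (integrable_one_sub_cos_of_levyIntegrand hν h)]
      refine Finset.sum_congr rfl fun i _ => ?_
      rw [integral_exp_mul_one_sub_cos_eq_levyExponent hν]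
      ring
    rw [e2]
    have hl (s) := tendsto_natCast_mul_exp_sub_one (levyExponent ν s)
    have := tendsto_finsetSum (Finset.univ : Finset (Fin d)) fun i _ =>
      ((hl t).sub ((hl (t + EuclideanSpace.single i h)).div_const 2)).sub
        ((hl (t - EuclideanSpace.single i h)).div_const 2)
    refine this.congr fun n => ?_
    rw [e1, Finset.mul_sum]
    refine Finset.sum_congr rfl fun i _ => ?_
    rw [hμ, hμ, hμ]
    ring
  -- Weak convergence tests bounded continuous functions; compact support supplies the bound.
  obtain ⟨C, hC⟩ := hFc.exists_bound_of_continuous hF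
  have := FiniteMeasure.tendsto_iff_forall_integral_tendsto.1 hlim
    (BoundedContinuousFunction.ofNormedAddCommGroup F hF C hC)
  simp only [BoundedContinuousFunction.coe_ofNormedAddCommGroup, hκ, hκ₀,
    integral_smul_nnreal_measure] at this
  have hwd (ρ : Measure 𝔼) :
      ∫ u, F u ∂(ρ.withDensity fun u => ENNReal.ofReal (cosWeight h u)) =
        ∫ u, F u * cosWeight h u ∂ρ := by
    rw [integral_withDensity_eq_integral_toReal_smul hmeas (by simp)]
    refine integral_congr_ae (ae_of_all _ fun u => ?_)
    simp [ENNReal.toReal_ofReal (cosWeight_nonneg h u), mul_comm]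
  simpa only [hwd, NNReal.smul_def, smul_eq_mul, NNReal.coe_add, NNReal.coe_natCast,
    NNReal.coe_one] using this

/-- Convergence of `N ∫ φ dμ_N` to `∫ φ dν` for `φ` continuous of bounded support and
`o(‖u‖²)` at the origin. -/
theorem integrable_and_tendsto_integral_of_isLittleO {ν : Measure 𝔼}
    (hν : ∀ t, Integrable (levyIntegrand t) ν) (μ : ℕ → Measure 𝔼)
    [∀ n, IsProbabilityMeasure (μ n)]
    (hμ : ∀ (n : ℕ) t, charFun (μ n) t = Complex.exp (-(levyExponent ν t / ((n : ℂ) + 1))))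
    {φ : 𝔼 → ℝ} (hφ : Continuous φ) (hφo : φ =o[𝓝 0] fun u => ‖u‖ ^ 2) {R : ℝ} (hR : 0 < R)
    (hφR : ∀ u, R < ‖u‖ → φ u = 0) :
    Integrable φ ν ∧
      Tendsto (fun n : ℕ => ((n : ℝ) + 1) * ∫ u, φ u ∂(μ n)) atTop (𝓝 (∫ u, φ u ∂ν)) := by
  -- With h = 1/R the quadratic lower bound on the weight holds for ‖u‖ < 2R, a neighbourhood of the
  -- closed R-ball outside which φ vanishes.
  set c : ℝ := 2 / Real.pi ^ 2 * R⁻¹ ^ 2 with hc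
  have hc0 : 0 < c := by positivity
  have hw {u : 𝔼} (hu : ‖u‖ < 2 * R) : c * ‖u‖ ^ 2 ≤ cosWeight R⁻¹ u := by
    refine mul_norm_sq_le_cosWeight ?_
    rw [abs_of_pos (by positivity)]
    calc R⁻¹ * ‖u‖ ≤ R⁻¹ * (2 * R) := by gcongr
      _ = 2 := by field_simp
  have hφ0 : φ 0 = 0 := by
    have := (hφo.def (zero_lt_one)).self_of_nhds
    simpa using this
  have hwpos {u : 𝔼} (hu : ‖u‖ < 2 * R) (hu0 : u ≠ 0) : 0 < cosWeight R⁻¹ u :=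
    lt_of_lt_of_le (by positivity) (hw hu)
  -- Division by zero returns 0, which is the continuous value at the origin since φ = o(‖u‖²).
  -- Further zeros of the weight lie beyond R, where φ = 0.
  set F : 𝔼 → ℝ := fun u => φ u / cosWeight R⁻¹ u with hF
  have hFR (u : 𝔼) (hu : R < ‖u‖) : F u = 0 := by simp [hF, hφR u hu]
  have hFφ (u : 𝔼) : F u * cosWeight R⁻¹ u = φ u := by
    by_cases h1 : R < ‖u‖
    · rw [hFR u h1, hφR u h1, zero_mul]
    · by_cases h2 : u = 0
      · simp [hF, h2, hφ0]
      · exact div_mul_cancel₀ _ (hwpos (by linarith) h2).ne'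
  have hFcont : Continuous F := by
    refine continuous_iff_continuousAt.2 fun u => ?_
    rcases lt_or_ge R ‖u‖ with h1 | h1
    · have : F =ᶠ[𝓝 u] fun _ => 0 := by
        filter_upwards [(isOpen_lt continuous_const continuous_norm).mem_nhds h1] with v hv
        exact hFR v hv
      exact continuousAt_const.congr this.symm
    by_cases h2 : u = 0
    · subst h2
      rw [ContinuousAt, show F 0 = 0 by simp [hF, hφ0], Metric.tendsto_nhds]
      intro ε hε
      have hnear : ∀ᶠ v : 𝔼 in 𝓝 0, ‖v‖ < 2 * R :=
        (isOpen_lt continuous_norm continuous_const).mem_nhds (by simpa using hR)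
      filter_upwards [hφo.def (show 0 < ε / 2 * c by positivity), hnear] with v hv hvR
      by_cases h3 : v = 0
      · simpa [h3, hF, hφ0] using hε
      · have hp := hwpos hvR h3
        rw [dist_zero_right, hF, norm_div, Real.norm_of_nonneg hp.le, div_lt_iff₀ hp]
        rw [norm_pow, norm_norm] at hv
        have h4 := hw hvR
        have h5 : ε / 2 * (c * ‖v‖ ^ 2) ≤ ε / 2 * cosWeight R⁻¹ v := by gcongr
        nlinarith [mul_pos hε hp]
    · exact hφ.continuousAt.div (continuous_cosWeight _).continuousAt
        (hwpos (by linarith) h2).ne'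
  have hFc : HasCompactSupport F :=
    HasCompactSupport.intro (isCompact_closedBall (0 : 𝔼) R) fun u hu =>
      hFR u (by simpa using hu)
  have hlim := tendsto_integral_mul_cosWeight hν μ hμ R⁻¹ hFcont hFc
  simp only [hFφ] at hlim
  refine ⟨?_, hlim⟩
  obtain ⟨C, hC⟩ := hFc.exists_bound_of_continuous hFcont
  have := (integrable_cosWeight hν R⁻¹).bdd_mul hFcont.aestronglyMeasurable (ae_of_all _ hC)
  simpa only [hFφ] using this

end Weight

/-! ### Removing the cutoff by uniform tail control. -/

section LimitTheorem

variable {d : ℕ}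

local notation "𝔼" => EuclideanSpace ℝ (Fin d)

/-- The radial cutoff equal to `1` for `‖u‖ ≤ R` and to `0` for `‖u‖ ≥ 2R`. -/
noncomputable def radialCutoff (R : ℝ) (u : 𝔼) : ℝ := max 0 (min 1 (2 - ‖u‖ / R))

theorem continuous_radialCutoff (R : ℝ) : Continuous (radialCutoff R : 𝔼 → ℝ) := by
  unfold radialCutoff
  fun_prop

theorem radialCutoff_nonneg (R : ℝ) (u : 𝔼) : 0 ≤ radialCutoff R u := le_max_left _ _

theorem radialCutoff_le_one (R : ℝ) (u : 𝔼) : radialCutoff R u ≤ 1 :=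
  max_le zero_le_one (min_le_left _ _)

theorem radialCutoff_eq_one {R : ℝ} (hR : 0 < R) {u : 𝔼} (hu : ‖u‖ ≤ R) :
    radialCutoff R u = 1 := by
  have : ‖u‖ / R ≤ 1 := (div_le_one hR).2 hu
  rw [radialCutoff, min_eq_left (by linarith), max_eq_right zero_le_one]

theorem radialCutoff_eq_zero {R : ℝ} (hR : 0 < R) {u : 𝔼} (hu : 2 * R < ‖u‖) :
    radialCutoff R u = 0 := by
  have : 2 < ‖u‖ / R := (lt_div_iff₀ hR).2 hu
  exact max_eq_left ((min_le_right _ _).trans (by linarith))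

/-- The tail of a finite moment tends to zero. -/
theorem tendsto_setLIntegral_tail {σ : Measure 𝔼} {F : 𝔼 → ENNReal} {r : 𝔼 → ℝ}
    (hr : Measurable r) (hfin : ∫⁻ x, F x ∂σ ≠ ⊤) :
    Tendsto (fun k : ℕ => ∫⁻ x in {x | (k : ℝ) < r x}, F x ∂σ) atTop (𝓝 0) := by
  have hms (k : ℕ) : MeasurableSet {x | (k : ℝ) < r x} := measurableSet_lt measurable_const hr
  have hanti : Antitone fun k : ℕ => {x | (k : ℝ) < r x} := fun k l hkl x (hx : (l : ℝ) < r x) =>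
    lt_of_le_of_lt (Nat.cast_le.2 hkl) hx
  have hempty : ⋂ k : ℕ, {x | (k : ℝ) < r x} = ∅ := by
    refine Set.eq_empty_of_forall_notMem fun x hx => ?_
    obtain ⟨k, hk⟩ := exists_nat_gt (r x)
    exact lt_asymm hk (Set.mem_iInter.1 hx k)
  -- Continuity from above for the finite measure with density F.
  have := tendsto_measure_iInter_atTop (μ := σ.withDensity F)
    (fun k => (hms k).nullMeasurableSet) hanti
    ⟨0, ((measure_mono (Set.subset_univ _)).trans_lt
      (by simpa [withDensity_apply] using hfin.lt_top)).ne⟩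
  rw [hempty, measure_empty] at this
  exact this.congr fun k => withDensity_apply _ (hms k)

/-- The limit theorem under a uniform control of the tails of `N μ_N`. -/
theorem levy_limit_of_tail_bound {ν : Measure 𝔼}
    (hν : ∀ t, Integrable (levyIntegrand t) ν) (μ : ℕ → Measure 𝔼)
    [∀ n, IsProbabilityMeasure (μ n)]
    (hμ : ∀ (n : ℕ) t, charFun (μ n) t = Complex.exp (-(levyExponent ν t / ((n : ℂ) + 1))))
    {f : 𝔼 → ℝ} (hf : Continuous f)
    {g : ℝ → ℝ} (hg_cont : ContinuousOn g (Set.Ici 0)) (hg_mono : MonotoneOn g (Set.Ici 0))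
    (hg_nonneg : ∀ t, 0 ≤ t → 0 ≤ g t)
    (hg_o : (fun u : 𝔼 => g ‖u‖) =o[𝓝 0] fun u => ‖u‖ ^ 2)
    (hfg : ∀ x, |f x| ≤ g ‖x‖)
    {σ : Measure 𝔼} [SFinite σ] {C : ENNReal} (hC : C ≠ ⊤) {c T : ℝ} (hc : 0 ≤ c)
    (htail : ∀ n : ℕ, ∀ t, T ≤ t →
      ((n + 1 : ℕ) : ENNReal) * μ n {x | t < ‖x‖} ≤ C * σ {x | t < c * ‖x‖})
    (hσ : ∫⁻ x, ENNReal.ofReal (g (c * ‖x‖)) ∂σ ≠ ⊤) :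
    Integrable f ν ∧ (∀ n, Integrable f (μ n)) ∧
      Tendsto (fun n : ℕ => ((n : ℝ) + 1) * ∫ x, f x ∂(μ n)) atTop (𝓝 (∫ x, f x ∂ν)) := by
  set G : 𝔼 → ℝ := fun u => g ‖u‖ with hG
  have hGc : Continuous G := hg_cont.comp_continuous continuous_norm fun x => norm_nonneg x
  have hG0 (u) : 0 ≤ G u := hg_nonneg _ (norm_nonneg u)
  -- the uniform tail estimate
  set τ : ℕ → ENNReal := fun k =>
    C * ∫⁻ x in {x | (k : ℝ) < c * ‖x‖}, ENNReal.ofReal (g (c * ‖x‖)) ∂σ with hτ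
  have hτfin (k) : τ k ≠ ⊤ :=
    ENNReal.mul_ne_top hC ((setLIntegral_le_lintegral _ _).trans_lt hσ.lt_top).ne
  have hτlim : Tendsto (fun k => (τ k).toReal) atTop (𝓝 0) := by
    have h1 := tendsto_setLIntegral_tail (r := fun x : 𝔼 => c * ‖x‖) (by fun_prop) hσ
    have h2 := ENNReal.Tendsto.const_mul h1 (Or.inr hC)
    rw [mul_zero] at h2
    exact (ENNReal.tendsto_toReal ENNReal.zero_ne_top).comp h2
  -- From K on the tail hypothesis applies (T) and the cutoff radius is positive (1).
  obtain ⟨K, hK⟩ := exists_nat_ge (max T 1)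
  have hKpos {k : ℕ} (hk : K ≤ k) : (0 : ℝ) < k :=
    zero_lt_one.trans_le (((le_max_right _ _).trans hK).trans (Nat.cast_le.2 hk))
  have hKT {k : ℕ} (hk : K ≤ k) : T ≤ k :=
    ((le_max_left _ _).trans hK).trans (Nat.cast_le.2 hk)
  have hms (k : ℕ) : MeasurableSet {x : 𝔼 | (k : ℝ) < ‖x‖} :=
    measurableSet_lt measurable_const measurable_norm
  have htl (n k : ℕ) (hk : K ≤ k) : ((n + 1 : ℕ) : ENNReal) *
      ∫⁻ x in {x | (k : ℝ) < ‖x‖}, ENNReal.ofReal (G x) ∂(μ n) ≤ τ k :=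
    setLIntegral_le_of_measure_lt_norm_le hc (hKpos hk).le (hKT hk) (htail n) hg_cont hg_mono
      hg_nonneg
  have hGn (n) : Integrable G (μ n) := by
    have hfin : ∫⁻ x in {x | (K : ℝ) < ‖x‖}, ENNReal.ofReal (G x) ∂(μ n) ≠ ⊤ := by
      refine ((le_mul_of_one_le_left' ?_).trans (htl n K le_rfl)).trans_lt (hτfin K).lt_top |>.ne
      exact_mod_cast Nat.succ_le_succ (Nat.zero_le n)
    have h1 : IntegrableOn G {x | (K : ℝ) < ‖x‖} (μ n) :=
      (lintegral_ofReal_ne_top_iff_integrable hGc.aestronglyMeasurable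
        (ae_of_all _ hG0)).1 hfin
    have h2 : IntegrableOn G {x | (K : ℝ) < ‖x‖}ᶜ (μ n) := by
      refine IntegrableOn.of_bound (measure_lt_top _ _) hGc.aestronglyMeasurable (g K) ?_
      refine (ae_restrict_iff' (hms K).compl).2 (ae_of_all _ fun x hx => ?_)
      rw [Real.norm_of_nonneg (hG0 x)]
      exact hg_mono (norm_nonneg x) (hKpos le_rfl).le (not_lt.1 hx)
    simpa using h1.union h2
  have hint (n k : ℕ) (hk : K ≤ k) :
      ((n : ℝ) + 1) * ∫ x in {x | (k : ℝ) < ‖x‖}, G x ∂(μ n) ≤ (τ k).toReal := by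
    have := ENNReal.toReal_mono (hτfin k) (htl n k hk)
    rw [ENNReal.toReal_mul, ← integral_eq_lintegral_of_nonneg_ae (ae_of_all _ hG0)
      hGc.aestronglyMeasurable, ENNReal.toReal_natCast] at this
    exact_mod_cast this
  -- functions dominated by `G`, after cutoff
  have hcut {φ : 𝔼 → ℝ} (hφ : Continuous φ) (hφG : ∀ x, |φ x| ≤ G x) {k : ℕ} (hk : K ≤ k) :
      Integrable (fun u => φ u * radialCutoff k u) ν ∧
        Tendsto (fun n : ℕ => ((n : ℝ) + 1) * ∫ u, φ u * radialCutoff k u ∂(μ n)) atTop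
          (𝓝 (∫ u, φ u * radialCutoff k u ∂ν)) := by
    refine integrable_and_tendsto_integral_of_isLittleO hν μ hμ
      (hφ.mul (continuous_radialCutoff _)) ?_ (R := 2 * k) (by linarith [hKpos hk])
      fun u hu => by rw [radialCutoff_eq_zero (hKpos hk) hu, mul_zero]
    refine IsBigO.trans_isLittleO (IsBigO.of_norm_le fun u => ?_) hg_o
    rw [norm_mul, Real.norm_eq_abs, Real.norm_of_nonneg (radialCutoff_nonneg _ _)]
    exact (mul_le_of_le_one_right (abs_nonneg _) (radialCutoff_le_one _ _)).trans (hφG u)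
  have hGabs (x) : |G x| ≤ G x := (abs_of_nonneg (hG0 x)).le
  have hcutn {φ : 𝔼 → ℝ} (hφ : Continuous φ) (hφG : ∀ x, |φ x| ≤ G x) (n k : ℕ) :
      Integrable (fun u => φ u * radialCutoff k u) (μ n) := by
    refine (hGn n).mono' (hφ.mul (continuous_radialCutoff _)).aestronglyMeasurable
      (ae_of_all _ fun u => ?_)
    rw [norm_mul, Real.norm_eq_abs, Real.norm_of_nonneg (radialCutoff_nonneg _ _)]
    exact (mul_le_of_le_one_right (abs_nonneg _) (radialCutoff_le_one _ _)).trans (hφG u)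
  have hGν : Integrable G ν := by
    have hcover : AECover ν atTop fun k : ℕ => Metric.closedBall (0 : 𝔼) ((k + K : ℕ) : ℝ) :=
      aecover_closedBall (tendsto_natCast_atTop_atTop.comp (tendsto_add_atTop_nat K))
    have hball (k : ℕ) : ∀ u ∈ Metric.closedBall (0 : 𝔼) ((k + K : ℕ) : ℝ),
        G u * radialCutoff ((k + K : ℕ) : ℝ) u = G u := fun u hu => by
      rw [radialCutoff_eq_one (hKpos (Nat.le_add_left K k)) (by simpa using hu), mul_one]
    have hk (k : ℕ) := hcut hGc hGabs (Nat.le_add_left K k)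
    have hbK (k : ℕ) : MeasurableSet (Metric.closedBall (0 : 𝔼) ((k + K : ℕ) : ℝ)) :=
      measurableSet_closedBall
    refine hcover.integrable_of_integral_bounded_of_nonneg_ae
      (∫ u, G u * radialCutoff K u ∂ν + (τ K).toReal) (fun k => ?_) (ae_of_all _ hG0)
      (Eventually.of_forall fun k => ?_)
    · exact (hk k).1.integrableOn.congr_fun (hball k) (hbK k)
    · calc ∫ u in Metric.closedBall (0 : 𝔼) ((k + K : ℕ) : ℝ), G u ∂ν
          = ∫ u in Metric.closedBall (0 : 𝔼) ((k + K : ℕ) : ℝ),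
              G u * radialCutoff ((k + K : ℕ) : ℝ) u ∂ν :=
            setIntegral_congr_fun (hbK k) fun u hu => (hball k u hu).symm
        _ ≤ ∫ u, G u * radialCutoff ((k + K : ℕ) : ℝ) u ∂ν :=
            setIntegral_le_integral (hk k).1
              (ae_of_all _ fun u => mul_nonneg (hG0 u) (radialCutoff_nonneg _ _))
        _ ≤ _ := by
            -- For each n, the integral cut off at k + K exceeds the one cut off at K by at most the
            -- tail beyond K. Letting n → ∞ gives a bound on the ν-integrals independent of k.
            refine le_of_tendsto_of_tendsto' (hk k).2
              (((hcut hGc hGabs le_rfl).2).add_const (τ K).toReal) fun n => ?_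
            refine le_trans ?_ (add_le_add_right (hint n K le_rfl) _)
            rw [← mul_add, ← integral_indicator (hms K),
              ← integral_add (hcutn hGc hGabs n K) ((hGn n).indicator (hms K))]
            refine mul_le_mul_of_nonneg_left ?_ (by positivity)
            refine integral_mono (hcutn hGc hGabs n _) ((hcutn hGc hGabs n K).add
              ((hGn n).indicator (hms K))) fun u => ?_
            have h1 : G u * radialCutoff ((k + K : ℕ) : ℝ) u ≤ G u :=
              mul_le_of_le_one_right (hG0 u) (radialCutoff_le_one _ _)
            refine h1.trans ?_
            by_cases hu : (K : ℝ) < ‖u‖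
            · rw [Set.indicator_of_mem (show u ∈ {x : 𝔼 | (K : ℝ) < ‖x‖} from hu)]
              exact le_add_of_nonneg_left (mul_nonneg (hG0 u) (radialCutoff_nonneg _ _))
            · rw [radialCutoff_eq_one (hKpos le_rfl) (not_lt.1 hu), mul_one]
              exact le_add_of_nonneg_right (Set.indicator_nonneg (fun x _ => hG0 x) u)
  have hfν : Integrable f ν := hGν.mono' hf.aestronglyMeasurable (ae_of_all _ hfg)
  have hfn (n) : Integrable f (μ n) := (hGn n).mono' hf.aestronglyMeasurable (ae_of_all _ hfg)
  refine ⟨hfν, hfn, ?_⟩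
  have hνlim : Tendsto (fun k : ℕ => ∫ u, f u * radialCutoff k u ∂ν) atTop (𝓝 (∫ u, f u ∂ν)) := by
    refine tendsto_integral_of_dominated_convergence G
      (fun k => (hf.mul (continuous_radialCutoff _)).aestronglyMeasurable) hGν
      (fun k => ae_of_all _ fun u => ?_) (ae_of_all _ fun u => ?_)
    · rw [norm_mul, Real.norm_eq_abs, Real.norm_of_nonneg (radialCutoff_nonneg _ _)]
      exact (mul_le_of_le_one_right (abs_nonneg _) (radialCutoff_le_one _ _)).trans (hfg u)
    · refine tendsto_const_nhds.congr' ?_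
      filter_upwards [eventually_ge_atTop K,
        tendsto_natCast_atTop_atTop.eventually (eventually_ge_atTop ‖u‖)] with k hk hku
      rw [radialCutoff_eq_one (hKpos hk) hku, mul_one]
  have herr (n k : ℕ) (hk : K ≤ k) : |((n : ℝ) + 1) * ∫ u, f u ∂(μ n)
      - ((n : ℝ) + 1) * ∫ u, f u * radialCutoff k u ∂(μ n)| ≤ (τ k).toReal := by
    refine le_trans ?_ (hint n k hk)
    rw [← mul_sub, abs_mul, abs_of_nonneg (by positivity : (0 : ℝ) ≤ n + 1),
      ← integral_sub (hfn n) (hcutn hf hfg n k), ← integral_indicator (hms k)]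
    refine mul_le_mul_of_nonneg_left ?_ (by positivity)
    refine norm_integral_le_of_norm_le (f := fun u => f u - f u * radialCutoff k u)
      ((hGn n).indicator (hms k)) (ae_of_all _ fun u => ?_)
    by_cases hu : (k : ℝ) < ‖u‖
    · rw [Set.indicator_of_mem (show u ∈ {x : 𝔼 | (k : ℝ) < ‖x‖} from hu)]
      rw [show f u - f u * radialCutoff k u = f u * (1 - radialCutoff k u) by ring, norm_mul,
        Real.norm_eq_abs, Real.norm_of_nonneg (sub_nonneg.2 (radialCutoff_le_one _ _))]
      exact (mul_le_of_le_one_right (abs_nonneg _)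
        (by linarith [radialCutoff_nonneg (k : ℝ) u])).trans (hfg u)
    · rw [radialCutoff_eq_one (hKpos hk) (not_lt.1 hu)]
      simpa using Set.indicator_nonneg (fun x _ => hG0 x) u
  rw [Metric.tendsto_atTop]
  intro ε hε
  -- The tail error is uniform in n, so the cutoff k can be fixed before N.
  obtain ⟨k, hk, hk1, hk2⟩ := ((eventually_ge_atTop K).and
    ((hτlim.eventually (gt_mem_nhds (show 0 < ε / 3 by positivity))).and
      (hνlim.eventually (Metric.ball_mem_nhds _ (show 0 < ε / 3 by positivity))))).exists
  obtain ⟨N, hN⟩ := Metric.tendsto_atTop.1 (hcut hf hfg hk).2 (ε / 3) (by positivity)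
  refine ⟨N, fun n hn => ?_⟩
  have h1 := hN n hn
  have h2 := herr n k hk
  rw [← Real.dist_eq] at h2
  have h3 := dist_triangle4 (((n : ℝ) + 1) * ∫ u, f u ∂(μ n))
    (((n : ℝ) + 1) * ∫ u, f u * radialCutoff k u ∂(μ n)) (∫ u, f u * radialCutoff k u ∂ν)
    (∫ u, f u ∂ν)
  linarith

end LimitTheorem

/-! ### Uniform tail bounds for the convolution roots. -/

section Tails

theorem exists_forall_measure_lt_norm_le {E : Type*} [NormedAddCommGroup E]
    [MeasurableSpace E] {S : Set (Measure E)} (hS : IsTightMeasureSet S)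
    {ε : ENNReal} (hε : 0 < ε) : ∃ T : ℝ, ∀ μ ∈ S, ∀ t, T ≤ t → μ {x | t < ‖x‖} ≤ ε := by
  have h := tendsto_measure_norm_gt_of_isTightMeasureSet hS
  obtain ⟨T, hT⟩ := eventually_atTop.1 (h.eventually (ge_mem_nhds hε))
  exact ⟨T, fun μ hμ t ht => (le_iSup₂ (f := fun (μ : Measure E) (_ : μ ∈ S) =>
    μ {x | t < ‖x‖}) μ hμ).trans (hT t ht)⟩

variable {E : Type*} [NormedAddCommGroup E] [InnerProductSpace ℝ E] [FiniteDimensional ℝ E]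
  [MeasurableSpace E] [BorelSpace E]

theorem exists_forall_measureReal_lt_norm_le (σ : Measure E) [IsProbabilityMeasure σ] :
    ∃ T : ℝ, ∀ t, T ≤ t → σ.real {x | t < ‖x‖} ≤ 1 / 4 := by
  obtain ⟨T, hT⟩ := exists_forall_measure_lt_norm_le (isTightMeasureSet_singleton (μ := σ))
    (ε := 4⁻¹) (by simp)
  refine ⟨T, fun t ht => ?_⟩
  have := ENNReal.toReal_mono (by simp) (hT σ rfl t ht)
  simpa [measureReal_def] using this

/-- Uniform tail bound for convolution roots of a symmetric law. -/
theorem exists_tail_bound_of_symmetric (σ : Measure E) [IsProbabilityMeasure σ]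
    (hσ : σ.map Neg.neg = σ) (hσ0 : ∀ t, charFun σ t ≠ 0) (μ : ℕ → Measure E)
    [∀ n, IsProbabilityMeasure (μ n)] (h : ∀ n t, charFun σ t = charFun (μ n) t ^ (n + 1)) :
    ∃ T : ℝ, ∀ n : ℕ, ∀ t, T ≤ t →
      ((n + 1 : ℕ) : ENNReal) * μ n {x | t < ‖x‖} ≤ 4 * σ {x | t < ‖x‖} := by
  obtain ⟨T, hT⟩ := exists_forall_measureReal_lt_norm_le σ
  refine ⟨T, fun n t ht => natCast_mul_measure_lt_norm_le (μ n) σ ?_ (h n) (hT t ht)⟩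
  refine map_neg_eq_self_of_charFun_pow n.succ_ne_zero (μ n) σ hσ (h n) fun t h0 => hσ0 t ?_
  rw [h n, h0, zero_pow n.succ_ne_zero]

/-- Uniform tail bound for convolution roots in terms of the symmetrized law. -/
theorem exists_tail_bound_symmetrization (σ : Measure E) [IsProbabilityMeasure σ]
    (hσ0 : ∀ t, charFun σ t ≠ 0) (μ : ℕ → Measure E) [∀ n, IsProbabilityMeasure (μ n)]
    (h : ∀ n t, charFun σ t = charFun (μ n) t ^ (n + 1)) (htight : IsTightMeasureSet (Set.range μ))
    {c : ℝ} (hc : 1 < c) :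
    ∃ T : ℝ, ∀ n : ℕ, ∀ t, T ≤ t →
      ((n + 1 : ℕ) : ENNReal) * μ n {x | t < ‖x‖} ≤
        8 * symmetrization σ {x | t < c * ‖x‖} := by
  have hc0 : 0 < c := zero_lt_one.trans hc
  obtain ⟨T₁, hT₁⟩ := exists_tail_bound_of_symmetric (symmetrization σ) (symmetrization_map_neg σ)
    (fun t => by rw [charFun_symmetrization]; exact mul_ne_zero (hσ0 _) (hσ0 _))
    (fun n => symmetrization (μ n))
    (fun n t => by rw [charFun_symmetrization, charFun_symmetrization, h n, h n, mul_pow])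
  obtain ⟨s, hs⟩ := exists_forall_measure_lt_norm_le htight (ε := 2⁻¹) (by simp)
  have hc1 : 0 < 1 - c⁻¹ := sub_pos.2 (inv_lt_one_of_one_lt₀ hc)
  -- The first entry puts t/c above the threshold of the symmetric bound; the second makes the
  -- tightness radius s at most (1 - 1/c) t.
  refine ⟨max (c * T₁) (s / (1 - c⁻¹)), fun n t ht => ?_⟩
  have h1 : T₁ ≤ c⁻¹ * t := by
    rw [inv_mul_eq_div, le_div_iff₀ hc0, mul_comm]
    exact (le_max_left _ _).trans ht
  have h2 : s ≤ (1 - c⁻¹) * t := by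
    rw [mul_comm, ← div_le_iff₀ hc1]
    exact (le_max_right _ _).trans ht
  have hset : {x : E | t < c * ‖x‖} = {x | c⁻¹ * t < ‖x‖} := by
    ext x
    exact (inv_mul_lt_iff₀ hc0).symm
  have hhalf : 1 / 2 ≤ μ n {x | ‖x‖ ≤ s} := by
    have h3 : {x : E | ‖x‖ ≤ s} = {x | s < ‖x‖}ᶜ := by
      ext x
      simp
    rw [h3, prob_compl_eq_one_sub (measurableSet_lt measurable_const measurable_norm), one_div,
      ← ENNReal.one_sub_inv_two]
    exact tsub_le_tsub_left (hs _ (Set.mem_range_self n) s le_rfl) 1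
  calc ((n + 1 : ℕ) : ENNReal) * μ n {x | t < ‖x‖}
      ≤ ((n + 1 : ℕ) : ENNReal) * (2 * symmetrization (μ n) {x | t < c * ‖x‖}) := by
        gcongr
        exact measure_lt_norm_le_two_mul_symmetrization (μ n) hc0 h2 hhalf
    _ = 2 * (((n + 1 : ℕ) : ENNReal) * symmetrization (μ n) {x | c⁻¹ * t < ‖x‖}) := by
        rw [hset]
        ring
    _ ≤ 2 * (4 * symmetrization σ {x | c⁻¹ * t < ‖x‖}) := by
        exact mul_le_mul_right (hT₁ n _ h1) 2
    _ = 8 * symmetrization σ {x | t < c * ‖x‖} := by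
        rw [hset, ← mul_assoc]
        norm_num

/-- Translates the moment condition stated on the product space into one on the symmetrized law. -/
theorem map_sub_prod_eq_symmetrization {Ω : Type*} [MeasurableSpace Ω] (P : Measure Ω)
    [IsProbabilityMeasure P] {X : Ω → E} (hX : AEMeasurable X P) :
    (P.prod P).map (fun ω => X ω.1 - X ω.2) = symmetrization (P.map X) := by
  have h1 : AEMeasurable (fun ω : Ω × Ω => X ω.1) (P.prod P) := hX.comp_fst
  have h2 : AEMeasurable (fun ω : Ω × Ω => X ω.2) (P.prod P) := hX.comp_snd
  have hind : IndepFun (fun ω : Ω × Ω => X ω.1) (fun ω : Ω × Ω => X ω.2) (P.prod P) :=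
    indepFun_prod₀ hX hX
  have hm1 : (P.prod P).map (fun ω : Ω × Ω => X ω.1) = P.map X := by
    conv_rhs => rw [← (measurePreserving_fst (μ := P) (ν := P)).map_eq]
    rw [AEMeasurable.map_map_of_aemeasurable (by rwa [measurePreserving_fst.map_eq])
      measurable_fst.aemeasurable]
    rfl
  have hm2 : (P.prod P).map (fun ω : Ω × Ω => X ω.2) = P.map X := by
    conv_rhs => rw [← (measurePreserving_snd (μ := P) (ν := P)).map_eq]
    rw [AEMeasurable.map_map_of_aemeasurable (by rwa [measurePreserving_snd.map_eq])
      measurable_snd.aemeasurable]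
    rfl
  have hprod := (indepFun_iff_map_prod_eq_prod_map_map h1 h2).1 hind
  rw [hm1, hm2] at hprod
  rw [symmetrization, ← hprod,
    AEMeasurable.map_map_of_aemeasurable (by fun_prop) (h1.prodMk h2)]
  rfl

end Tails

/-! ### Properties of g and the main theorem. -/

theorem eq_zero_and_nonneg_of_isLittleO_sq {g : ℝ → ℝ} (hg_cont : ContinuousOn g (Set.Ici 0))
    (hg_mono : MonotoneOn g (Set.Ici 0)) (hg_o : g =o[𝓝[>] (0 : ℝ)] fun t => t ^ 2) :
    g 0 = 0 ∧ ∀ t, 0 ≤ t → 0 ≤ g t := by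
  have h0 : g 0 = 0 := by
    have h1 : Tendsto g (𝓝[>] 0) (𝓝 (g 0)) :=
      (hg_cont 0 Set.self_mem_Ici).mono_left (nhdsWithin_mono _ Set.Ioi_subset_Ici_self)
    have h2 : Tendsto (fun t : ℝ => t ^ 2) (𝓝[>] 0) (𝓝 0) := by
      have : Tendsto (fun t : ℝ => t ^ 2) (𝓝 0) (𝓝 (0 ^ 2)) := (continuous_pow 2).tendsto 0
      rw [zero_pow two_ne_zero] at this
      exact this.mono_left nhdsWithin_le_nhds
    exact tendsto_nhds_unique h1 (hg_o.trans_tendsto h2)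
  exact ⟨h0, fun t ht => h0 ▸ hg_mono Set.self_mem_Ici ht ht⟩

/-- The right-hand filter omits t = 0, while u = 0 belongs to every neighbourhood of the origin;
`h0` covers that point. -/
theorem isLittleO_comp_norm {E : Type*} [NormedAddCommGroup E] {g : ℝ → ℝ} (h0 : g 0 = 0)
    (hg_o : g =o[𝓝[>] (0 : ℝ)] fun t => t ^ 2) :
    (fun u : E => g ‖u‖) =o[𝓝 0] fun u => ‖u‖ ^ 2 := by
  refine IsLittleO.of_bound fun ε hε => ?_
  have h1 := eventually_nhdsWithin_iff.1 (hg_o.def hε)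
  have h2 : Tendsto (fun u : E => ‖u‖) (𝓝 0) (𝓝 0) := tendsto_norm_zero
  filter_upwards [h2.eventually h1] with u hu
  by_cases h : u = 0
  · simp [h, h0]
  · exact hu (norm_pos_iff.2 h)

/-- A moment of `X - Y` is controlled by a moment of `2X`. -/
theorem lintegral_symmetrization_ne_top {E : Type*} [NormedAddCommGroup E]
    [InnerProductSpace ℝ E] [FiniteDimensional ℝ E] [MeasurableSpace E] [BorelSpace E]
    (σ : Measure E) [IsProbabilityMeasure σ] {g : ℝ → ℝ} (hg_cont : ContinuousOn g (Set.Ici 0))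
    (hg_mono : MonotoneOn g (Set.Ici 0)) {c : ℝ} (hc : 0 ≤ c)
    (h : ∫⁻ x, ENNReal.ofReal (g (2 * c * ‖x‖)) ∂σ ≠ ⊤) :
    ∫⁻ x, ENNReal.ofReal (g (c * ‖x‖)) ∂(symmetrization σ) ≠ ⊤ := by
  have hm (a : ℝ) (ha : 0 ≤ a) : Measurable fun x : E => ENNReal.ofReal (g (a * ‖x‖)) :=
    (hg_cont.comp_continuous (by fun_prop)
      fun x => mul_nonneg ha (norm_nonneg x)).measurable.ennreal_ofReal
  have hm2 := hm (2 * c) (by positivity)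
  rw [symmetrization, lintegral_map (hm c hc) (by fun_prop)]
  -- ‖x - y‖ is at most twice the larger norm, and the maximum of the two values of g is bounded by
  -- their sum.
  have hle (p : E × E) : ENNReal.ofReal (g (c * ‖p.1 - p.2‖)) ≤
      ENNReal.ofReal (g (2 * c * ‖p.1‖)) + ENNReal.ofReal (g (2 * c * ‖p.2‖)) := by
    have hn := norm_sub_le p.1 p.2
    have key (x : E) (hx : ‖p.1 - p.2‖ ≤ 2 * ‖x‖) :
        ENNReal.ofReal (g (c * ‖p.1 - p.2‖)) ≤ ENNReal.ofReal (g (2 * c * ‖x‖)) := by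
      refine ENNReal.ofReal_le_ofReal (hg_mono (mul_nonneg hc (norm_nonneg _))
        (mul_nonneg (by positivity) (norm_nonneg _)) ?_)
      calc c * ‖p.1 - p.2‖ ≤ c * (2 * ‖x‖) := by gcongr
        _ = 2 * c * ‖x‖ := by ring
    rcases le_total ‖p.1‖ ‖p.2‖ with h1 | h1
    · exact (key p.2 (by linarith)).trans le_add_self
    · exact (key p.1 (by linarith)).trans le_self_add
  refine ((lintegral_mono hle).trans_lt ?_).ne
  rw [lintegral_add_left (by exact hm2.comp measurable_fst)]
  have e1 := (measurePreserving_fst (μ := σ) (ν := σ)).lintegral_comp hm2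
  have e2 := (measurePreserving_snd (μ := σ) (ν := σ)).lintegral_comp hm2
  rw [e1, e2]
  exact ENNReal.add_lt_top.2 ⟨h.lt_top, h.lt_top⟩

theorem mainTheorem7 {d : ℕ} {Ω : Type*} [MeasurableSpace Ω] (P : Measure Ω)
    [IsProbabilityMeasure P] (X : Ω → EuclideanSpace ℝ (Fin d)) (hX : AEMeasurable X P)
    (ν : Measure (EuclideanSpace ℝ (Fin d)))
    (hXν : IsCenteredPureJumpLaw (P.map X) ν)
    -- `U n` (for `n ≥ 1`) has characteristic exponent `Λ_X / n`; each lives on its own space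
    {Ω' : ℕ → Type*} [∀ n, MeasurableSpace (Ω' n)] (Q : ∀ n, Measure (Ω' n))
    [∀ n, IsProbabilityMeasure (Q n)]
    (U : ∀ n, Ω' n → EuclideanSpace ℝ (Fin d)) (hU : ∀ n, 1 ≤ n → AEMeasurable (U n) (Q n))
    (hUn : ∀ n : ℕ, 1 ≤ n → ∀ t,
      charFun ((Q n).map (U n)) t = Complex.exp (-(levyExponent ν t / (n : ℂ))))
    (f : EuclideanSpace ℝ (Fin d) → ℝ) (hf : Continuous f)
    (g : ℝ → ℝ) (hg_cont : ContinuousOn g (Set.Ici 0)) (hg_mono : MonotoneOn g (Set.Ici 0))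
    (hg_o : g =o[𝓝[>] (0 : ℝ)] fun t => t ^ 2)
    (hfg : ∀ x, |f x| ≤ g ‖x‖)
    (hX2 : Integrable (fun ω => ‖X ω‖ ^ 2) P)
    (hmom :
      (∃ c : ℝ, 1 < c ∧
        Integrable (fun ω : Ω × Ω => g (c * ‖X ω.1 - X ω.2‖)) (P.prod P)) ∨
      (∃ c : ℝ, 1 < c ∧ Integrable (fun ω => g (2 * c * ‖X ω‖)) P) ∨
      (IdentDistrib X (fun ω => -X ω) P P ∧ Integrable (fun ω => g ‖X ω‖) P)) :
    Integrable f ν ∧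
      (∀ n : ℕ, 1 ≤ n → Integrable (fun ω => f (U n ω)) (Q n)) ∧
      Tendsto (fun n : ℕ => (n : ℝ) * ∫ ω, f (U n ω) ∂(Q n)) atTop (𝓝 (∫ x, f x ∂ν)) := by
  obtain ⟨hg0, hg_nonneg⟩ := eq_zero_and_nonneg_of_isLittleO_sq hg_cont hg_mono hg_o
  have hν := hXν.integrable
  set σ := P.map X with hσdef
  have hσ : IsProbabilityMeasure σ := Measure.isProbabilityMeasure_map hX
  have hσ0 (t) : charFun σ t ≠ 0 := by
    rw [hXν.charFun_eq]
    exact Complex.exp_ne_zero _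
  -- Index shift: `μ n` is the law of `U (n + 1)`, so every index is admissible.
  let μ : ℕ → Measure (EuclideanSpace ℝ (Fin d)) := fun n => (Q (n + 1)).map (U (n + 1))
  have hμprob (n) : IsProbabilityMeasure (μ n) :=
    Measure.isProbabilityMeasure_map (hU (n + 1) n.succ_pos)
  have hμ (n : ℕ) (t) :
      charFun (μ n) t = Complex.exp (-(levyExponent ν t / ((n : ℂ) + 1))) := by
    have := hUn (n + 1) n.succ_pos t
    push_cast at this
    exact this
  have hroot (n : ℕ) (t) : charFun σ t = charFun (μ n) t ^ (n + 1) := by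
    have hne : (n : ℂ) + 1 ≠ 0 := by exact_mod_cast n.succ_ne_zero
    rw [hμ, hXν.charFun_eq, ← Complex.exp_nat_mul]
    congr 1
    push_cast
    field_simp
  have htight : IsTightMeasureSet (Set.range μ) := by
    -- The characteristic functions tend to the constant 1, which is continuous at 0.
    refine isTightMeasureSet_of_tendsto_charFun (f := fun _ => 1) continuousAt_const fun t => ?_
    have h1 : Tendsto (fun n : ℕ => -(levyExponent ν t / ((n : ℂ) + 1))) atTop (𝓝 0) := by
      have := (tendsto_one_div_add_atTop_nhds_zero_nat (𝕜 := ℂ)).const_mul (-levyExponent ν t)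
      rw [mul_zero] at this
      refine this.congr fun n => ?_
      ring
    have h2 := (Complex.continuous_exp.tendsto 0).comp h1
    rw [Complex.exp_zero] at h2
    exact h2.congr fun n => (hμ n t).symm
  have hmeas (c : ℝ) (hc : 0 ≤ c) :
      Continuous fun x : EuclideanSpace ℝ (Fin d) => g (c * ‖x‖) :=
    hg_cont.comp_continuous (by fun_prop) fun x => mul_nonneg hc (norm_nonneg x)
  have hmoment (c : ℝ) (hc : 0 ≤ c) (h : Integrable (fun ω => g (c * ‖X ω‖)) P) :
      ∫⁻ x, ENNReal.ofReal (g (c * ‖x‖)) ∂σ ≠ ⊤ := by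
    have h1 : Integrable (fun x => g (c * ‖x‖)) σ :=
      (integrable_map_measure (hmeas c hc).aestronglyMeasurable hX).2 h
    exact (lintegral_ofReal_ne_top_iff_integrable h1.aestronglyMeasurable
      (ae_of_all _ fun x => hg_nonneg _ (mul_nonneg hc (norm_nonneg x)))).2 h1
  have hcore : Integrable f ν ∧ (∀ n, Integrable f (μ n)) ∧
      Tendsto (fun n : ℕ => ((n : ℝ) + 1) * ∫ x, f x ∂(μ n)) atTop (𝓝 (∫ x, f x ∂ν)) := by
    have hsymm (c : ℝ) (hc : 1 < c)
        (h : ∫⁻ x, ENNReal.ofReal (g (c * ‖x‖)) ∂(symmetrization σ) ≠ ⊤) :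
        Integrable f ν ∧ (∀ n, Integrable f (μ n)) ∧
          Tendsto (fun n : ℕ => ((n : ℝ) + 1) * ∫ x, f x ∂(μ n)) atTop (𝓝 (∫ x, f x ∂ν)) := by
      obtain ⟨T, hT⟩ := exists_tail_bound_symmetrization σ hσ0 μ hroot htight hc
      exact levy_limit_of_tail_bound hν μ hμ hf hg_cont hg_mono hg_nonneg
        (isLittleO_comp_norm hg0 hg_o) hfg (C := 8) (by simp) (by linarith) hT h
    rcases hmom with ⟨c, hc, h⟩ | ⟨c, hc, h⟩ | ⟨hid, h⟩
    · have hc0 : 0 ≤ c := by linarith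
      refine hsymm c hc ?_
      have hXX : AEMeasurable (fun ω : Ω × Ω => X ω.1 - X ω.2) (P.prod P) :=
        hX.comp_fst.sub hX.comp_snd
      have h1 : Integrable (fun x => g (c * ‖x‖)) (symmetrization σ) := by
        rw [← map_sub_prod_eq_symmetrization P hX]
        exact (integrable_map_measure (hmeas c hc0).aestronglyMeasurable hXX).2 h
      exact (lintegral_ofReal_ne_top_iff_integrable h1.aestronglyMeasurable
        (ae_of_all _ fun x => hg_nonneg _ (mul_nonneg hc0 (norm_nonneg x)))).2 h1
    · have hc0 : 0 ≤ c := by linarith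
      exact hsymm c hc (lintegral_symmetrization_ne_top σ hg_cont hg_mono hc0
        (hmoment (2 * c) (by positivity) h))
    · have hneg : σ.map Neg.neg = σ := by
        rw [hσdef, AEMeasurable.map_map_of_aemeasurable measurable_neg.aemeasurable hX]
        exact hid.map_eq.symm
      obtain ⟨T, hT⟩ := exists_tail_bound_of_symmetric σ hneg hσ0 μ hroot
      exact levy_limit_of_tail_bound hν μ hμ hf hg_cont hg_mono hg_nonneg
        (isLittleO_comp_norm hg0 hg_o) hfg (C := 4) (c := 1) (by simp) zero_le_one
        (by simpa only [one_mul] using hT) (hmoment 1 zero_le_one (by simpa only [one_mul] using h))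
  obtain ⟨h1, h2, h3⟩ := hcore
  refine ⟨h1, fun n hn => ?_, ?_⟩
  · obtain ⟨m, rfl⟩ := Nat.exists_eq_add_of_le' hn
    exact (integrable_map_measure hf.aestronglyMeasurable (hU (m + 1) hn)).1 (h2 m)
  -- The limit ignores n = 0, which undoes the index shift.
  · refine (tendsto_add_atTop_iff_nat 1).1 (h3.congr fun n => ?_)
    rw [integral_map (hU (n + 1) n.succ_pos) hf.aestronglyMeasurable]
    push_cast
    rfl
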